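/- Let $\mathbb I=[0,1]^2\setminus\{(0,r):r>0\}$ with the lexicographic order (a complete linear order), and write $\hat r=(r,r)$. Let $\mathcal L$ be a first-order language with countably many predicate, function and constant symbols. Formulas of the first-order rational G\"odel logic over $\mathcal L$ are built from atomic formulas $P(t_1,\dots,t_k)$ ($P$ a predicate symbol, no built-in equality) and nullary connectives $\bar r$, $r\in\mathbb Q\cap[0,1]$, by $\wedge$, $\to$, $\forall x$, $\exists x$ (other connectives are abbreviations, e.g. $\neg\varphi:=\varphi\to\bar 1$ and $\varphi\vee\psi:=((\varphi\to\psi)\to\psi)\wedge((\psi\to\varphi)\to\varphi)$). An $\mathcal L$-structure $\mathcal M$ is a nonempty set $M$ with a function $P^{\mathcal M}:M^k\to\mathbb I$ for each $k$-ary predicate symbol $P$, a function $f^{\mathcal M}:M^k\to M$ for each $k$-ary function symbol $f$, and an element $c^{\mathcal M}\in M$ for each constant symbol $c$. Formulas take values in $\mathbb I$: $\bar r$ has value $\hat r$, atomic formulas are evaluated by the $P^{\mathcal M}$, $\wedge$ is $\max$, $\varphi\to\psi$ has value $\hat 0$ if the value of $\varphi$ is $\ge$ that of $\psi$ and otherwise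 the value of $\psi$, and $\forall x$, $\exists x$ are the supremum and the infimum over all values of $x$ in $M$. Thus $\hat 0$ is absolute truth. For a sentence $\varphi$, $\mathcal M\models\varphi$ means that $\varphi$ has value $\hat 0$ in $\mathcal M$; for a set $T$ of sentences, $\mathcal M\models T$ means $\mathcal M\models\psi$ for all $\psi\in T$, and $T\models\varphi$ means that every $\mathcal L$-structure $\mathcal M\models T$ satisfies $\mathcal M\models\varphi$. **Theorem (approximate entailment compactness).** Let $T$ be a set of $\mathcal L$-sentences and $\varphi$ an $\mathcal L$-sentence. Then $T\models\varphi$ if and only if for every integer $n\ge 1$ there is a finite subset $T_n\subseteq T$ such that $T_n\models\overline{n^{-1}}\to\varphi$. -/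

import Mathlib

universe u v w

namespace RGL

/-! ### The set of truth values -/

/-- The set `𝕀 = [0,1]² \ {(0,r) : r > 0}` of truth values. -/
@[ext]
structure TruthValue : Type where
  fst : ℝ
  snd : ℝ
  fst_mem : fst ∈ Set.Icc (0 : ℝ) 1
  snd_mem : snd ∈ Set.Icc (0 : ℝ) 1
  not_excluded : ¬ (fst = 0 ∧ 0 < snd)

namespace TruthValue

/-- The lexicographic order on `𝕀`. -/
noncomputable instance : LinearOrder TruthValue :=
  LinearOrder.lift' (fun x : TruthValue => (toLex (x.fst, x.snd) : ℝ ×ₗ ℝ)) fun x y h => by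
    have h' := Prod.ext_iff.1 (toLex.injective h)
    exact TruthValue.ext h'.1 h'.2

/-- The element `r̂ = (r, r)` of `𝕀`, for a rational `r` in `[0,1]`. -/
def hat (r : Set.Icc (0 : ℚ) 1) : TruthValue where
  fst := ((r : ℚ) : ℝ)
  snd := ((r : ℚ) : ℝ)
  fst_mem := ⟨by exact_mod_cast r.2.1, by exact_mod_cast r.2.2⟩
  snd_mem := ⟨by exact_mod_cast r.2.1, by exact_mod_cast r.2.2⟩
  not_excluded := fun h => h.2.ne' h.1

/-- The least element `0̂ = (0,0)` of `𝕀`: absolute truth. -/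
def zeroHat : TruthValue := hat ⟨0, by norm_num⟩

theorem le_iff (x y : TruthValue) :
    x ≤ y ↔ x.fst < y.fst ∨ x.fst = y.fst ∧ x.snd ≤ y.snd :=
  Prod.Lex.le_iff

theorem zeroHat_le (x : TruthValue) : zeroHat ≤ x := by
  rw [le_iff]
  have e1 : zeroHat.fst = 0 := by simp [zeroHat, hat]
  have e2 : zeroHat.snd = 0 := by simp [zeroHat, hat]
  rw [e1, e2]
  rcases x.fst_mem.1.lt_or_eq with h | h
  · exact Or.inl h
  · exact Or.inr ⟨h, x.snd_mem.1⟩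

/-- Every subset of `𝕀` has a least upper bound. -/
theorem exists_isLUB (s : Set TruthValue) : ∃ x, IsLUB s x := by
  rcases s.eq_empty_or_nonempty with rfl | ⟨x₀, hx₀⟩
  · exact ⟨zeroHat, by simp, fun y _ => zeroHat_le y⟩
  set A : Set ℝ := TruthValue.fst '' s with hA
  have hAne : A.Nonempty := ⟨_, x₀, hx₀, rfl⟩
  have hAbd : BddAbove A := ⟨1, by rintro _ ⟨x, _, rfl⟩; exact x.fst_mem.2⟩
  set a := sSup A with ha
  have hle : ∀ x ∈ s, x.fst ≤ a := fun x hx => le_csSup hAbd ⟨x, hx, rfl⟩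
  have ha0 : 0 ≤ a := x₀.fst_mem.1.trans (hle x₀ hx₀)
  have ha1 : a ≤ 1 := csSup_le hAne (by rintro _ ⟨x, _, rfl⟩; exact x.fst_mem.2)
  by_cases hatt : ∃ x ∈ s, x.fst = a
  · obtain ⟨x₁, hx₁, hx₁a⟩ := hatt
    set B : Set ℝ := TruthValue.snd '' {x ∈ s | x.fst = a} with hB
    have hBne : B.Nonempty := ⟨_, x₁, ⟨hx₁, hx₁a⟩, rfl⟩
    have hBbd : BddAbove B := ⟨1, by rintro _ ⟨x, _, rfl⟩; exact x.snd_mem.2⟩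
    set b := sSup B with hb
    have hleB : ∀ x ∈ s, x.fst = a → x.snd ≤ b :=
      fun x hx hxa => le_csSup hBbd ⟨x, ⟨hx, hxa⟩, rfl⟩
    have hb0 : 0 ≤ b := x₁.snd_mem.1.trans (hleB x₁ hx₁ hx₁a)
    have hb1 : b ≤ 1 := csSup_le hBne (by rintro _ ⟨x, _, rfl⟩; exact x.snd_mem.2)
    have hab : ¬ (a = 0 ∧ 0 < b) := by
      rintro ⟨h, hpos⟩
      have : b ≤ 0 := csSup_le hBne (by
        rintro _ ⟨x, ⟨_, hxa⟩, rfl⟩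
        exact not_lt.1 fun hlt => x.not_excluded ⟨hxa.trans h, hlt⟩)
      exact absurd hpos (not_lt.2 this)
    refine ⟨⟨a, b, ⟨ha0, ha1⟩, ⟨hb0, hb1⟩, hab⟩, ?_, ?_⟩
    · intro x hx
      rw [le_iff]
      rcases (hle x hx).lt_or_eq with h | h
      · exact Or.inl h
      · exact Or.inr ⟨h, hleB x hx h⟩
    · intro y hy
      rw [le_iff]
      have hay : a ≤ y.fst := csSup_le hAne (by
        rintro _ ⟨x, hx, rfl⟩
        rcases (le_iff x y).1 (hy hx) with h | h
        · exact h.le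
        · exact h.1.le)
      rcases hay.lt_or_eq with h | h
      · exact Or.inl h
      · refine Or.inr ⟨h, csSup_le hBne ?_⟩
        rintro _ ⟨x, ⟨hx, hxa⟩, rfl⟩
        rcases (le_iff x y).1 (hy hx) with h' | h'
        · exact absurd (hxa.trans h) h'.ne
        · exact h'.2
  · refine ⟨⟨a, 0, ⟨ha0, ha1⟩, ⟨le_rfl, zero_le_one⟩, fun h => lt_irrefl _ h.2⟩, ?_, ?_⟩
    · intro x hx
      rw [le_iff]
      exact Or.inl ((hle x hx).lt_of_ne fun h => hatt ⟨x, hx, h⟩)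
    · intro y hy
      rw [le_iff]
      have hay : a ≤ y.fst := csSup_le hAne (by
        rintro _ ⟨x, hx, rfl⟩
        rcases (le_iff x y).1 (hy hx) with h | h
        · exact h.le
        · exact h.1.le)
      rcases hay.lt_or_eq with h | h
      · exact Or.inl h
      · exact Or.inr ⟨h, y.snd_mem.1⟩

/-- Every subset of `𝕀` has a greatest lower bound. -/
theorem exists_isGLB (s : Set TruthValue) : ∃ x, IsGLB s x := by
  obtain ⟨x, hx⟩ := exists_isLUB (lowerBounds s)
  exact ⟨x, isLUB_lowerBounds.1 hx⟩

/-- Suprema in `𝕀`. -/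
noncomputable instance : SupSet TruthValue := ⟨fun s => (exists_isLUB s).choose⟩

/-- Infima in `𝕀`. -/
noncomputable instance : InfSet TruthValue := ⟨fun s => (exists_isGLB s).choose⟩

theorem isLUB_sSup (s : Set TruthValue) : IsLUB s (sSup s) := (exists_isLUB s).choose_spec

theorem isGLB_sInf (s : Set TruthValue) : IsGLB s (sInf s) := (exists_isGLB s).choose_spec

/-- The Gödel implication on `𝕀`, with `0̂` as absolute truth. -/
noncomputable def imp (x y : TruthValue) : TruthValue := if y ≤ x then zeroHat else y

end TruthValue

/-! ### Syntax

Symbols are those of a Mathlib first-order language (constants are `0`-ary function symbols), the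
variables are the natural numbers, and terms are Mathlib's terms. -/

/-- The formulas of rational Gödel logic. The remaining connectives are abbreviations. -/
inductive Formula (L : FirstOrder.Language.{u, v}) : Type (max u v)
  /-- the nullary connective `r̄` -/
  | const (r : Set.Icc (0 : ℚ) 1) : Formula L
  | pred {n : ℕ} (P : L.Relations n) (t : Fin n → L.Term ℕ) : Formula L
  | and (φ ψ : Formula L) : Formula L
  | imp (φ ψ : Formula L) : Formula L
  | all (x : ℕ) (φ : Formula L) : Formula L
  | ex (x : ℕ) (φ : Formula L) : Formula L

variable {L : FirstOrder.Language.{u, v}}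

/-- The set of variables of a term. -/
def termVars : L.Term ℕ → Set ℕ
  | .var x => {x}
  | .func _ t => ⋃ i, termVars (t i)

/-- The set of free variables of a formula. -/
def Formula.freeVars : Formula L → Set ℕ
  | .const _ => ∅
  | .pred _ t => ⋃ i, termVars (t i)
  | .and φ ψ => φ.freeVars ∪ ψ.freeVars
  | .imp φ ψ => φ.freeVars ∪ ψ.freeVars
  | .all x φ => φ.freeVars \ {x}
  | .ex x φ => φ.freeVars \ {x}

variable (L) in
/-- Sentences: formulas without free variables. -/
abbrev Sentence : Type (max u v) := {φ : Formula L // φ.freeVars = ∅}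

variable (L) in
/-- A theory is an arbitrary set of sentences. -/
abbrev Theory : Type (max u v) := Set (Sentence L)

/-- The sentence `r̄`. -/
def Sentence.const (r : Set.Icc (0 : ℚ) 1) : Sentence L := ⟨.const r, rfl⟩

/-- The sentence `φ → ψ`. -/
def Sentence.imp (φ ψ : Sentence L) : Sentence L :=
  ⟨.imp φ.1 ψ.1, by simp [Formula.freeVars, φ.2, ψ.2]⟩

/-! ### Semantics -/

variable (L) in
/-- An `L`-structure: a nonempty universe, with `𝕀`-valued predicates. -/
structure Structure : Type (max u v (w + 1)) where
  carrier : Type w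
  nonempty : Nonempty carrier
  predMap {n : ℕ} : L.Relations n → (Fin n → carrier) → TruthValue
  funMap {n : ℕ} : L.Functions n → (Fin n → carrier) → carrier

namespace Structure

variable (M : Structure.{u, v, w} L)

/-- The interpretation of a term under an assignment. -/
def termVal (σ : ℕ → M.carrier) : L.Term ℕ → M.carrier
  | .var x => σ x
  | .func f t => M.funMap f fun i => termVal σ (t i)

/-- The interpretation of a formula under an assignment. -/
noncomputable def val : Formula L → (ℕ → M.carrier) → TruthValue
  | .const r, _ => TruthValue.hat r
  | .pred P t, σ => M.predMap P fun i => M.termVal σ (t i)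
  | .and φ ψ, σ => max (val φ σ) (val ψ σ)
  | .imp φ ψ, σ => (val φ σ).imp (val ψ σ)
  | .all x φ, σ => sSup (Set.range fun a : M.carrier => val φ (Function.update σ x a))
  | .ex x φ, σ => sInf (Set.range fun a : M.carrier => val φ (Function.update σ x a))

theorem termVal_congr {σ τ : ℕ → M.carrier} (t : L.Term ℕ)
    (h : ∀ x ∈ termVars t, σ x = τ x) : M.termVal σ t = M.termVal τ t := by
  induction t with
  | var x => exact h x rfl
  | func f t ih =>
    simp only [termVal]
    congr 1
    funext i
    exact ih i fun x hx => h x (Set.mem_iUnion.2 ⟨i, hx⟩)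

/-- The interpretation of a formula depends only on the values of its free variables. -/
theorem val_congr (φ : Formula L) {σ τ : ℕ → M.carrier}
    (h : ∀ x ∈ φ.freeVars, σ x = τ x) : M.val φ σ = M.val φ τ := by
  induction φ generalizing σ τ with
  | const r => rfl
  | pred P t =>
    simp only [val]
    congr 1
    funext i
    exact M.termVal_congr _ fun x hx => h x (Set.mem_iUnion.2 ⟨i, hx⟩)
  | and φ ψ ih₁ ih₂ =>
    simp only [val]
    rw [ih₁ fun x hx => h x (Or.inl hx), ih₂ fun x hx => h x (Or.inr hx)]
  | imp φ ψ ih₁ ih₂ =>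
    simp only [val]
    rw [ih₁ fun x hx => h x (Or.inl hx), ih₂ fun x hx => h x (Or.inr hx)]
  | all y φ ih =>
    simp only [val]
    congr 2
    funext a
    refine ih fun x hx => ?_
    by_cases hxy : x = y
    · subst hxy; simp
    · simpa [hxy] using h x ⟨hx, hxy⟩
  | ex y φ ih =>
    simp only [val]
    congr 2
    funext a
    refine ih fun x hx => ?_
    by_cases hxy : x = y
    · subst hxy; simp
    · simpa [hxy] using h x ⟨hx, hxy⟩

/-- `M ⊨ φ`: the sentence `φ` takes the value `0̂` (under every assignment; the value of a sentence
does not depend on the assignment). -/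
def Satisfies (φ : Sentence L) : Prop :=
  ∀ σ : ℕ → M.carrier, M.val φ.1 σ = TruthValue.zeroHat

/-- `M ⊨ T`. -/
def SatisfiesTheory (T : Theory L) : Prop := ∀ ψ ∈ T, M.Satisfies ψ

end Structure

/-- `T ⊨ φ`: every `L`-structure (with universe in `Type w`) satisfying `T` satisfies `φ`. -/
def Entails (T : Theory L) (φ : Sentence L) : Prop :=
  ∀ M : Structure.{u, v, w} L, M.SatisfiesTheory T → M.Satisfies φ

/-- The rational number `1/n` in `[0,1]`, for a positive integer `n`. -/
def unitFrac (n : ℕ+) : Set.Icc (0 : ℚ) 1 :=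
  ⟨1 / (n : ℕ), by positivity,
    (div_le_one (by exact_mod_cast n.pos)).2 (by exact_mod_cast n.pos)⟩

end RGL

namespace RGL

open Filter

/-! From right to left: in a model of `T` the value of `φ` lies below every point (1/n, 1/n), so its
first coordinate is 0. The column above 0 has been removed from the truth values, hence the value is
absolute truth.

From left to right, suppose that for some n every finite part of `T` has a model in which `φ`
exceeds (1/n, 1/n). An ultraproduct of these models takes its values in an ultrapower of the truth
values, which must be brought back to the truth values with the rational constants, suprema and
infima intact. Since the language is countable, a Skolem-closed part with a countable set A of
points and a countable dense set D of values can be chosen (`exists_countable_isSkolemClosed`). The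
set D is mapped to the truth values by `Scale.exists_collapse`. The first coordinate is the standard
part. Each nonempty fibre over a positive standard part is a countable dense order with at least two
points, so by Cantor's theorem it embeds continuously in [0,1], and this embedding gives the second
coordinate. An automorphism of [0,1] puts the rational constant of the fibre in its place. The fibre
over 0 is collapsed to absolute truth. Implication survives this: if two values become wrongly
comparable, the conclusion has already become absolute truth. The loss of infinitesimals is also why
the slack 1/n appears: a value above (1/n, 1/n) stays at or above it, so `φ` fails in a model of
`T`.

The axioms of `Scale` isolate what the collapse needs. They are universal statements with at most
one order hypothesis on the element, so they pass from the truth values to ultrapowers and to closed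
subsets. -/

/-! ### Continuous embeddings of countable dense orders -/

/-- A map of linear orders is bicontinuous if it is continuous for monotone limits on both sides. -/
structure Bicontinuous {α β : Type*} [LinearOrder α] [LinearOrder β] (g : α → β) : Prop where
  left : ∀ x c, c < g x → ∃ y < x, c < g y
  right : ∀ x c, g x < c → ∃ y, x < y ∧ g y < c

theorem Bicontinuous.orderIso_comp {α β γ : Type*} [LinearOrder α] [LinearOrder β] [LinearOrder γ]
    {g : α → β} (hg : Bicontinuous g) (Φ : β ≃o γ) : Bicontinuous (Φ ∘ g) where
  left x c hc := by
    obtain ⟨y, hy, h⟩ := hg.left x (Φ.symm c) (Φ.symm_apply_lt.2 hc)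
    exact ⟨y, hy, Φ.symm_apply_lt.1 h⟩
  right x c hc := by
    obtain ⟨y, hy, h⟩ := hg.right x (Φ.symm c) (Φ.lt_symm_apply.2 hc)
    exact ⟨y, hy, Φ.lt_symm_apply.1 h⟩

/-- A countable dense linear order embeds in the unit interval, preserving suprema and infima. -/
theorem exists_strictMono_bicontinuous (F : Type*) [LinearOrder F] [Countable F] [DenselyOrdered F]
    [Nontrivial F] : ∃ g : F → Set.Icc (0 : ℝ) 1, StrictMono g ∧ Bicontinuous g := by
  classical
  -- Possible endpoints are removed so that Cantor's theorem applies; they are sent to 0 and 1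
  -- afterwards.
  let I : Set F := {x | (∃ y, y < x) ∧ ∃ z, x < z}
  have hmem : ∀ {a b c : F}, a < b → b < c → b ∈ I := fun h h' => ⟨⟨_, h⟩, ⟨_, h'⟩⟩
  have : Nonempty I := by
    obtain ⟨a, b, hab⟩ := exists_pair_lt F
    obtain ⟨c, h, h'⟩ := exists_between hab
    exact ⟨⟨c, hmem h h'⟩⟩
  have : NoMinOrder I := ⟨fun ⟨x, ⟨y, hy⟩, z, hz⟩ => by
    obtain ⟨c, h, h'⟩ := exists_between hy
    exact ⟨⟨c, hmem h h'⟩, h'⟩⟩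
  have : NoMaxOrder I := ⟨fun ⟨x, ⟨y, hy⟩, z, hz⟩ => by
    obtain ⟨c, h, h'⟩ := exists_between hz
    exact ⟨⟨c, hmem h h'⟩, h⟩⟩
  have : DenselyOrdered I := ⟨fun a b hab => by
    obtain ⟨c, h, h'⟩ := exists_between (show a.1 < b.1 from hab)
    exact ⟨⟨c, hmem h h'⟩, h, h'⟩⟩
  have : Nonempty (Set.Ioo (0 : ℚ) 1) := ⟨⟨1 / 2, by norm_num, by norm_num⟩⟩
  obtain ⟨φ⟩ := Order.iso_of_countable_dense I (Set.Ioo (0 : ℚ) 1)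
  let g : F → Set.Icc (0 : ℝ) 1 := fun x =>
    if h : x ∈ I then ⟨((φ ⟨x, h⟩ : ℚ) : ℝ), by exact_mod_cast (φ ⟨x, h⟩).2.1.le,
      by exact_mod_cast (φ ⟨x, h⟩).2.2.le⟩ else if ∃ y, y < x then ⊤ else ⊥
  have gI : ∀ (x : F) (h : x ∈ I), (g x : ℝ) = ((φ ⟨x, h⟩ : ℚ) : ℝ) := fun x h => by
    simp only [g, dif_pos h]
  have gT : ∀ x : F, x ∉ I → (∃ y, y < x) → g x = ⊤ := fun x h h' => by
    simp only [g, dif_neg h, if_pos h']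
  have gB : ∀ x : F, (¬ ∃ y, y < x) → g x = ⊥ := fun x h' => by
    have h : x ∉ I := fun h => h' h.1
    simp only [g, dif_neg h, if_neg h']
  have gpos : ∀ x ∈ I, (⊥ : Set.Icc (0 : ℝ) 1) < g x := fun x h => by
    rw [← Subtype.coe_lt_coe, gI x h]
    change (0 : ℝ) < _
    exact_mod_cast (φ ⟨x, h⟩).2.1
  have glt : ∀ x ∈ I, g x < (⊤ : Set.Icc (0 : ℝ) 1) := fun x h => by
    rw [← Subtype.coe_lt_coe, gI x h]
    change _ < (1 : ℝ)
    exact_mod_cast (φ ⟨x, h⟩).2.2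
  have hbt : (⊥ : Set.Icc (0 : ℝ) 1) < ⊤ := by
    rw [← Subtype.coe_lt_coe]
    exact zero_lt_one
  have gmono : StrictMono g := by
    intro x y hxy
    by_cases hx : ∃ z, z < x
    · have hxI : x ∈ I := ⟨hx, y, hxy⟩
      by_cases hy : y ∈ I
      · rw [← Subtype.coe_lt_coe, gI x hxI, gI y hy]
        exact_mod_cast φ.strictMono (show (⟨x, hxI⟩ : I) < ⟨y, hy⟩ from hxy)
      · rw [gT y hy ⟨x, hxy⟩]
        exact glt x hxI
    · rw [gB x hx]
      by_cases hy : y ∈ I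
      · exact gpos y hy
      · rw [gT y hy ⟨x, hxy⟩]
        exact hbt
  -- The image contains every rational of (0,1), hence is dense; with strict monotonicity this gives
  -- continuity on both sides.
  have key : ∀ c d : Set.Icc (0 : ℝ) 1, c < d → ∃ y, c < g y ∧ g y < d := by
    intro c d hcd
    obtain ⟨q, hq, hq'⟩ := exists_rat_btwn (show (c : ℝ) < d from hcd)
    have h0 : (0 : ℚ) < q := by exact_mod_cast c.2.1.trans_lt hq
    have h1 : q < (1 : ℚ) := by exact_mod_cast hq'.trans_le d.2.2
    have := gI (φ.symm ⟨q, h0, h1⟩).1 (φ.symm ⟨q, h0, h1⟩).2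
    simp only [Subtype.coe_eta, OrderIso.apply_symm_apply] at this
    refine ⟨(φ.symm ⟨q, h0, h1⟩).1, ?_, ?_⟩
    · rw [← Subtype.coe_lt_coe, this]; exact hq
    · rw [← Subtype.coe_lt_coe, this]; exact hq'
  refine ⟨g, gmono, ⟨fun x c hc => ?_, fun x c hc => ?_⟩⟩
  · obtain ⟨y, h, h'⟩ := key _ _ hc
    exact ⟨y, gmono.lt_iff_lt.1 h', h⟩
  · obtain ⟨y, h, h'⟩ := key _ _ hc
    exact ⟨y, gmono.lt_iff_lt.1 h, h'⟩

/-- The order automorphisms of the unit interval are transitive on interior points. -/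
theorem exists_orderIso_Icc (t s : Set.Icc (0 : ℝ) 1) (ht : ⊥ < t) (ht' : t < ⊤)
    (hs : ⊥ < s) (hs' : s < ⊤) : ∃ Φ : Set.Icc (0 : ℝ) 1 ≃o Set.Icc (0 : ℝ) 1, Φ t = s := by
  have ht0 : (0 : ℝ) < t := ht
  have ht1 : (t : ℝ) < 1 := ht'
  have hs0 : (0 : ℝ) < s := hs
  have hs1 : (s : ℝ) < 1 := hs'
  -- The automorphism is a power map, with exponent solving t ^ α = s.
  set α : ℝ := Real.log s / Real.log t with hα
  have hlt := Real.log_neg ht0 ht1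
  have hls := Real.log_neg hs0 hs1
  have hα0 : 0 < α := div_pos_of_neg_of_neg hls hlt
  let f : Set.Icc (0 : ℝ) 1 → Set.Icc (0 : ℝ) 1 := fun x =>
    ⟨(x : ℝ) ^ α, Real.rpow_nonneg x.2.1 _, Real.rpow_le_one x.2.1 x.2.2 hα0.le⟩
  have hf : StrictMono f := fun x y hxy => Real.rpow_lt_rpow x.2.1 hxy hα0
  have hsurj : Function.Surjective f := fun y =>
    ⟨⟨(y : ℝ) ^ α⁻¹, Real.rpow_nonneg y.2.1 _, Real.rpow_le_one y.2.1 y.2.2 (inv_pos.2 hα0).le⟩,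
      Subtype.ext (Real.rpow_inv_rpow y.2.1 hα0.ne')⟩
  refine ⟨hf.orderIsoOfSurjective f hsurj, Subtype.ext ?_⟩
  change (t : ℝ) ^ α = s
  rw [Real.rpow_def_of_pos ht0, hα, mul_div_cancel₀ _ hlt.ne, Real.exp_log hs0]

/-! ### Linear orders containing a copy of the rational unit interval -/

/-- Constants `h r` for the rationals of `[0,1]`, together with two operations that bound an
element from below and from above without changing its standard part. -/
structure Scale (D : Type*) [LinearOrder D] where
  h : Set.Icc (0 : ℚ) 1 → D
  lo : D → D
  hi : D → D
  h_strictMono : StrictMono h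
  h_zero_le : ∀ x, h 0 ≤ x
  le_h_one : ∀ x, x ≤ h 1
  lo_le : ∀ x, lo x ≤ x
  le_hi : ∀ x, x ≤ hi x
  lo_lt_hi : ∀ x, h 0 < x → lo x < hi x
  lt_lo : ∀ x p q, p < q → h q ≤ x → h p ≤ lo x
  hi_lt : ∀ x p q, p < q → x ≤ h p → hi x ≤ h q
  lo_h_lt : ∀ r, 0 < r → lo (h r) < h r
  lt_hi_h : ∀ r, 0 < r → r < 1 → h r < hi (h r)

namespace Scale

variable {D : Type*} [LinearOrder D] (S : Scale D)

/-- The standard part of an element. -/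
noncomputable def st (x : D) : ℝ := sSup {r : ℝ | ∃ q : Set.Icc (0 : ℚ) 1, S.h q ≤ x ∧ r = (q : ℚ)}

theorem bddAbove_st (x : D) :
    BddAbove {r : ℝ | ∃ q : Set.Icc (0 : ℚ) 1, S.h q ≤ x ∧ r = (q : ℚ)} :=
  ⟨1, by rintro _ ⟨q, _, rfl⟩; exact_mod_cast q.2.2⟩

theorem le_st {q : Set.Icc (0 : ℚ) 1} {x : D} (hq : S.h q ≤ x) : ((q : ℚ) : ℝ) ≤ S.st x :=
  le_csSup (S.bddAbove_st x) ⟨q, hq, rfl⟩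

theorem st_le {q : Set.Icc (0 : ℚ) 1} {x : D} (hq : x ≤ S.h q) : S.st x ≤ (q : ℚ) := by
  refine csSup_le ⟨_, 0, S.h_zero_le x, rfl⟩ ?_
  rintro _ ⟨p, hp, rfl⟩
  exact_mod_cast S.h_strictMono.le_iff_le.1 (hp.trans hq)

theorem h_lt_of_lt_st {q : Set.Icc (0 : ℚ) 1} {x : D} (hq : ((q : ℚ) : ℝ) < S.st x) :
    S.h q < x :=
  not_le.1 fun h => (S.st_le h).not_gt hq

theorem lt_h_of_st_lt {q : Set.Icc (0 : ℚ) 1} {x : D} (hq : S.st x < (q : ℚ)) :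
    x < S.h q :=
  not_le.1 fun h => (S.le_st h).not_gt hq

theorem st_h (q : Set.Icc (0 : ℚ) 1) : S.st (S.h q) = (q : ℚ) :=
  le_antisymm (S.st_le le_rfl) (S.le_st le_rfl)

theorem st_nonneg (x : D) : 0 ≤ S.st x := by
  simpa using S.le_st (S.h_zero_le x)

theorem st_le_one (x : D) : S.st x ≤ 1 := by
  simpa using S.st_le (S.le_h_one x)

theorem st_mono : Monotone S.st := fun x y hxy =>
  csSup_le_csSup (S.bddAbove_st y) ⟨_, 0, S.h_zero_le x, rfl⟩
    fun _ ⟨q, hq, h⟩ => ⟨q, hq.trans hxy, h⟩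

theorem exists_rat_between {a b : ℝ} (ha : 0 ≤ a) (hb : b ≤ 1) (hab : a < b) :
    ∃ q : Set.Icc (0 : ℚ) 1, a < (q : ℚ) ∧ ((q : ℚ) : ℝ) < b := by
  obtain ⟨q, hq, hq'⟩ := exists_rat_btwn hab
  exact ⟨⟨q, by exact_mod_cast ha.trans hq.le, by exact_mod_cast hq'.le.trans hb⟩, hq, hq'⟩

/-- A gap between the two standard parts would contain rationals p < q with `h q ≤ x`, and `lt_lo`
then puts `h p` below `lo x`. The slack between p and q costs nothing because the rationals are
dense. -/
theorem st_lo (x : D) : S.st (S.lo x) = S.st x := by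
  refine le_antisymm (S.st_mono (S.lo_le x)) (not_lt.1 fun hlt => ?_)
  obtain ⟨p, hp, hp'⟩ := exists_rat_between (S.st_nonneg _) (S.st_le_one _) hlt
  obtain ⟨q, hq, hq'⟩ := exists_rat_between (by exact_mod_cast p.2.1) (S.st_le_one _) hp'
  exact (S.le_st (S.lt_lo x p q (by exact_mod_cast hq) (S.h_lt_of_lt_st hq').le)).not_gt hp

theorem st_hi (x : D) : S.st (S.hi x) = S.st x := by
  refine le_antisymm (not_lt.1 fun hlt => ?_) (S.st_mono (S.le_hi x))
  obtain ⟨p, hp, hp'⟩ := exists_rat_between (S.st_nonneg _) (S.st_le_one _) hlt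
  obtain ⟨q, hq, hq'⟩ := exists_rat_between (by exact_mod_cast p.2.1) (S.st_le_one _) hp'
  exact (S.st_le (S.hi_lt x p q (by exact_mod_cast hq) (S.lt_h_of_st_lt hp).le)).not_gt hq'

/-- The elements with a given standard part embed in the unit interval; if that standard part is
a rational constant, the embedding can be normalised there. -/
theorem exists_fibre_map [Countable D] [DenselyOrdered D] (s : ℝ) (hs : 0 < s) :
    ∃ g : {x : D // S.st x = s} → Set.Icc (0 : ℝ) 1, StrictMono g ∧ Bicontinuous g ∧
      ∀ x q, S.h q = x.1 → (g x : ℝ) = (q : ℚ) := by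
  set F := {x : D // S.st x = s}
  rcases isEmpty_or_nonempty F with hF | ⟨⟨x₀, hx₀⟩⟩
  · exact ⟨fun x => (hF.false x).elim, fun x => (hF.false x).elim,
      ⟨fun x => (hF.false x).elim, fun x => (hF.false x).elim⟩, fun x => (hF.false x).elim⟩
  have hlohi : ∀ x : F, S.lo x.1 < S.hi x.1 := fun x => S.lo_lt_hi _ <| S.h_lt_of_lt_st <| by
    simpa [x.2] using hs
  have : Nontrivial F := ⟨⟨⟨S.lo x₀, (S.st_lo x₀).trans hx₀⟩, ⟨S.hi x₀, (S.st_hi x₀).trans hx₀⟩,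
    fun h => (hlohi ⟨x₀, hx₀⟩).ne (congrArg Subtype.val h)⟩⟩
  have : DenselyOrdered F := ⟨fun a b hab => by
    obtain ⟨c, h, h'⟩ := exists_between (show a.1 < b.1 from hab)
    exact ⟨⟨c, le_antisymm ((S.st_mono h'.le).trans_eq b.2)
      (a.2.symm.trans_le (S.st_mono h.le))⟩, h, h'⟩⟩
  obtain ⟨g, hg, hg'⟩ := exists_strictMono_bicontinuous F
  by_cases hr : ∃ q : Set.Icc (0 : ℚ) 1, ((q : ℚ) : ℝ) = s
  · obtain ⟨q, rfl⟩ := hr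
    have huniq : ∀ (x : F) p, S.h p = x.1 → p = q := fun x p hp => by
      have := x.2
      rw [← hp, S.st_h] at this
      exact Subtype.ext (by exact_mod_cast this)
    have hq0 : (0 : Set.Icc (0 : ℚ) 1) < q := by
      rw [← Subtype.coe_lt_coe]; exact_mod_cast hs
    let c : F := ⟨S.h q, S.st_h q⟩
    -- The constant `h 1` is the greatest element, so no automorphism is needed: continuity from the
    -- right already forces its image to be 1.
    by_cases hq1 : q = 1
    · refine ⟨g, hg, hg', fun x p hp => ?_⟩
      have hp1 := (huniq x p hp).trans hq1
      have : g x = ⊤ := by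
        by_contra hne
        obtain ⟨y, hy, -⟩ := hg'.right x ⊤ (lt_top_iff_ne_top.2 hne)
        refine (S.le_h_one y.1).not_gt ?_
        rw [← hp1, hp]
        exact hy
      rw [this, hp1]
      simp
    · have hq1 : q < 1 := lt_of_le_of_ne (Subtype.coe_le_coe.1 q.2.2) hq1
      -- `lo` and `hi` keep the constant away from both ends of its fibre, so its image is interior
      -- and can be moved to q.
      have hc0 : ⊥ < g c := bot_le.trans_lt
        (hg (show (⟨S.lo c.1, (S.st_lo _).trans c.2⟩ : F) < c from S.lo_h_lt q hq0))
      have hc1 : g c < ⊤ := (hg (show c < (⟨S.hi c.1, (S.st_hi _).trans c.2⟩ : F) from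
        S.lt_hi_h q hq0 hq1)).trans_le le_top
      obtain ⟨Φ, hΦ⟩ := exists_orderIso_Icc (g c)
        ⟨((q : ℚ) : ℝ), by exact_mod_cast q.2.1, by exact_mod_cast q.2.2⟩ hc0 hc1
        hs
        (show ((q : ℚ) : ℝ) < 1 by exact_mod_cast hq1)
      refine ⟨Φ ∘ g, Φ.strictMono.comp hg, hg'.orderIso_comp Φ, fun x p hp => ?_⟩
      obtain rfl := huniq x p hp
      have hx : x = c := Subtype.ext hp.symm
      rw [hx, Function.comp_apply, hΦ]
  · refine ⟨g, hg, hg', fun x q hq => (hr ⟨q, ?_⟩).elim⟩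
    rw [← x.2, ← hq, S.st_h]

end Scale

theorem TruthValue.lt_iff (x y : TruthValue) :
    x < y ↔ x.fst < y.fst ∨ x.fst = y.fst ∧ x.snd < y.snd :=
  Prod.Lex.lt_iff

/-- This is where the exclusion of the points (0, r) with r > 0 enters. -/
theorem TruthValue.fst_pos {b : TruthValue} (hb : zeroHat < b) : 0 < b.fst := by
  refine lt_of_le_of_ne b.fst_mem.1 fun h => ?_
  rcases (lt_iff _ _).1 hb with h' | h'
  · simp [zeroHat, hat, ← h] at h'
  · exact b.not_excluded ⟨h.symm, by simpa [zeroHat, hat] using h'.2⟩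

theorem TruthValue.eq_zeroHat {b : TruthValue} (hb : b.fst = 0) : b = zeroHat := by
  by_contra hne
  exact (fst_pos (lt_of_le_of_ne (zeroHat_le b) (Ne.symm hne))).ne' hb

namespace Scale

/-- A countable dense order with a scale maps to the truth values, preserving suprema, infima and
the rational constants; only elements infinitely close to absolute truth are identified. -/
theorem exists_collapse {D : Type*} [LinearOrder D] (S : Scale D) [Countable D]
    [DenselyOrdered D] : ∃ e : D → TruthValue,
      (∀ q, e (S.h q) = TruthValue.hat q) ∧ Monotone e ∧
      (∀ x y, x < y → e y ≠ TruthValue.zeroHat → e x < e y) ∧ Bicontinuous e := by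
  classical
  have H := fun s : {s : ℝ // 0 < s} => S.exists_fibre_map s.1 s.2
  choose g hg hg' hgq using H
  let e : D → TruthValue := fun x => if hx : 0 < S.st x then
    ⟨S.st x, g ⟨S.st x, hx⟩ ⟨x, rfl⟩, ⟨S.st_nonneg x, S.st_le_one x⟩, (g _ _).2,
      fun h => hx.ne' h.1⟩ else TruthValue.zeroHat
  have efst : ∀ x, (e x).fst = S.st x := fun x => by
    by_cases hx : 0 < S.st x
    · simp only [e, dif_pos hx]
    · simp only [e, dif_neg hx]
      rw [le_antisymm (not_lt.1 hx) (S.st_nonneg x)]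
      simp [TruthValue.zeroHat, TruthValue.hat]
  have esnd : ∀ (s : {s : ℝ // 0 < s}) (x : {x : D // S.st x = s.1}), (e x.1).snd = g s x := by
    rintro ⟨s, hs⟩ ⟨x, hx⟩
    change S.st x = s at hx
    subst hx
    simp only [e, dif_pos hs]
  have eh : ∀ q, e (S.h q) = TruthValue.hat q := by
    intro q
    by_cases hq : 0 < S.st (S.h q)
    · refine TruthValue.ext ((efst _).trans (S.st_h q)) ?_
      rw [esnd ⟨_, hq⟩ ⟨_, rfl⟩]
      exact hgq ⟨_, hq⟩ ⟨_, rfl⟩ q rfl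
    · have h0 := le_antisymm (not_lt.1 hq) (S.st_nonneg _)
      rw [TruthValue.eq_zeroHat ((efst _).trans h0),
        TruthValue.eq_zeroHat (b := TruthValue.hat q) ((S.st_h q).symm.trans h0)]
  have elt : ∀ x y, x < y → e y ≠ TruthValue.zeroHat → e x < e y := by
    intro x y hxy hy
    have hpos : 0 < S.st y := lt_of_le_of_ne (S.st_nonneg y)
      fun h => hy (TruthValue.eq_zeroHat ((efst y).trans h.symm))
    rw [TruthValue.lt_iff, efst, efst]
    rcases (S.st_mono hxy.le).lt_or_eq with h | h
    · exact Or.inl h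
    · refine Or.inr ⟨h, ?_⟩
      rw [esnd ⟨_, hpos⟩ ⟨x, h⟩, esnd ⟨_, hpos⟩ ⟨y, rfl⟩]
      exact hg ⟨_, hpos⟩ hxy
  have emono : Monotone e := fun x y hxy => by
    by_cases hy : e y = TruthValue.zeroHat
    · have h0 : S.st y = 0 := by
        rw [← efst, hy]
        simp [TruthValue.zeroHat, TruthValue.hat]
      rw [hy, TruthValue.eq_zeroHat
        ((efst x).trans (le_antisymm ((S.st_mono hxy).trans_eq h0) (S.st_nonneg x)))]
    · rcases hxy.lt_or_eq with h | rfl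
      exacts [(elt x y h hy).le, le_rfl]
  refine ⟨e, eh, emono, elt, ?_, ?_⟩
  · intro x c hc
    have hpos : 0 < S.st x := efst x ▸ TruthValue.fst_pos ((TruthValue.zeroHat_le c).trans_lt hc)
    rcases (TruthValue.lt_iff _ _).1 hc with h | ⟨h, h'⟩
    · rw [efst] at h
      obtain ⟨q, hq, hq'⟩ := exists_rat_between c.fst_mem.1 (S.st_le_one x) h
      refine ⟨S.h q, S.h_lt_of_lt_st hq', ?_⟩
      rw [eh, TruthValue.lt_iff]
      exact Or.inl hq
    · rw [esnd ⟨_, hpos⟩ ⟨x, rfl⟩] at h'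
      obtain ⟨y, hy, hy'⟩ := (hg' ⟨_, hpos⟩).left ⟨x, rfl⟩ ⟨c.snd, c.snd_mem⟩ h'
      refine ⟨y, hy, (TruthValue.lt_iff _ _).2 (Or.inr ⟨?_, ?_⟩)⟩
      · rw [h, efst, efst, y.2]
      · rw [esnd ⟨_, hpos⟩ y]; exact hy'
  · intro x c hc
    have hle : S.st x ≤ c.fst := by
      rw [← efst]
      rcases (TruthValue.lt_iff _ _).1 hc with h | h
      exacts [h.le, h.1.le]
    by_cases hlt : S.st x < c.fst
    -- This case includes every collapsed x: a bound c above absolute truth has positive first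
    -- coordinate, so a rational constant fits in between.
    · obtain ⟨q, hq, hq'⟩ := exists_rat_between (S.st_nonneg x) c.fst_mem.2 hlt
      refine ⟨S.h q, S.lt_h_of_st_lt hq, ?_⟩
      rw [eh, TruthValue.lt_iff]
      exact Or.inl hq'
    · have h := le_antisymm hle (not_lt.1 hlt)
      have hpos : 0 < S.st x := h ▸ TruthValue.fst_pos ((TruthValue.zeroHat_le _).trans_lt hc)
      have h' : (e x).snd < c.snd := by
        rcases (TruthValue.lt_iff _ _).1 hc with h' | h'
        · exact absurd ((efst x).trans h) h'.ne
        · exact h'.2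
      rw [esnd ⟨_, hpos⟩ ⟨x, rfl⟩] at h'
      obtain ⟨y, hy, hy'⟩ := (hg' ⟨_, hpos⟩).right ⟨x, rfl⟩ ⟨c.snd, c.snd_mem⟩ h'
      refine ⟨y, hy, (TruthValue.lt_iff _ _).2 (Or.inr ⟨?_, ?_⟩)⟩
      · rw [← h, efst, y.2]
      · rw [esnd ⟨_, hpos⟩ y]; exact hy'

end Scale

/-! ### Scales on truth values, ultrapowers and subsets -/

/-- The truth values `(a, 0)` and `(a, 1)` bound `(a, b)`. -/
noncomputable def TruthValue.scale : Scale TruthValue where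
  h := hat
  lo x := ⟨x.fst, 0, x.fst_mem, ⟨le_rfl, zero_le_one⟩, fun h => lt_irrefl _ h.2⟩
  -- Over 0 the only truth value is (0,0), so the upper bound cannot be (0,1) there.
  hi x := ⟨x.fst, if x.fst = 0 then 0 else 1, x.fst_mem, by split_ifs <;> simp, fun h => by
    simp [h.1] at h⟩
  h_strictMono p q hpq := (lt_iff _ _).2 (Or.inl (by
    change ((p : ℚ) : ℝ) < (q : ℚ)
    exact_mod_cast hpq))
  h_zero_le := zeroHat_le
  le_h_one x := by
    rw [le_iff]
    simpa [hat, le_iff_lt_or_eq, x.snd_mem.2] using x.fst_mem.2.lt_or_eq.imp_right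
      fun h => (⟨h, x.snd_mem.2.lt_or_eq⟩ : _ ∧ _)
  lo_le x := (le_iff _ _).2 (Or.inr ⟨rfl, x.snd_mem.1⟩)
  le_hi x := (le_iff _ _).2 (Or.inr ⟨rfl, by
    by_cases h : x.fst = 0
    · simpa [h] using fun h' => x.not_excluded ⟨h, h'⟩
    · simpa [h] using x.snd_mem.2⟩)
  lo_lt_hi x hx := (lt_iff _ _).2 (Or.inr ⟨rfl, by simp [(fst_pos hx).ne']⟩)
  lt_lo x p q hpq hq := (le_iff _ _).2 (Or.inl (by
    change ((p : ℚ) : ℝ) < x.fst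
    have h1 : ((p : ℚ) : ℝ) < (q : ℚ) := by exact_mod_cast hpq
    have h2 : ((q : ℚ) : ℝ) ≤ x.fst := ((le_iff _ _).1 hq).elim (fun h => le_of_lt h) fun h => h.1.le
    exact h1.trans_le h2))
  hi_lt x p q hpq hp := (le_iff _ _).2 (Or.inl (by
    change x.fst < (q : ℚ)
    have h1 : ((p : ℚ) : ℝ) < (q : ℚ) := by exact_mod_cast hpq
    have h2 : x.fst ≤ (p : ℚ) := ((le_iff _ _).1 hp).elim (fun h => le_of_lt h) fun h => h.1.le
    exact h2.trans_lt h1))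
  lo_h_lt r hr := (lt_iff _ _).2 (Or.inr ⟨rfl, by
    change (0 : ℝ) < (r : ℚ)
    exact_mod_cast hr⟩)
  lt_hi_h r hr hr' := (lt_iff _ _).2 (Or.inr ⟨rfl, by
    have h0 : (0 : ℝ) < (r : ℚ) := by exact_mod_cast hr
    have h1 : ((r : ℚ) : ℝ) < 1 := by exact_mod_cast hr'
    simpa [hat, h0.ne'] using h1⟩)

instance : DenselyOrdered TruthValue := ⟨fun x y hxy => by
  rcases (TruthValue.lt_iff _ _).1 hxy with h | ⟨h, h'⟩
  · obtain ⟨c, hc, hc'⟩ := exists_between h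
    exact ⟨⟨c, 0, ⟨x.fst_mem.1.trans hc.le, hc'.le.trans y.fst_mem.2⟩, ⟨le_rfl, zero_le_one⟩,
      fun h => lt_irrefl _ h.2⟩, (TruthValue.lt_iff _ _).2 (Or.inl hc),
      (TruthValue.lt_iff _ _).2 (Or.inl hc')⟩
  · obtain ⟨c, hc, hc'⟩ := exists_between h'
    exact ⟨⟨x.fst, c, x.fst_mem, ⟨x.snd_mem.1.trans hc.le, hc'.le.trans y.snd_mem.2⟩,
      fun h0 => y.not_excluded ⟨h ▸ h0.1, h0.2.trans hc'⟩⟩,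
      (TruthValue.lt_iff _ _).2 (Or.inr ⟨rfl, hc⟩), (TruthValue.lt_iff _ _).2 (Or.inr ⟨h, hc'⟩)⟩⟩

section Germ

variable {ι : Type*} {X : Type*} [LinearOrder X]

instance Germ.denselyOrdered [DenselyOrdered X] (U : Ultrafilter ι) :
    DenselyOrdered (Germ (U : Filter ι) X) := ⟨fun a b => by
  induction a, b using Germ.inductionOn₂ with | _ f g =>
  intro hab
  have H : ∀ i, ∃ c, f i < g i → f i < c ∧ c < g i := fun i => by
    by_cases h : f i < g i
    · obtain ⟨c, hc⟩ := exists_between h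
      exact ⟨c, fun _ => hc⟩
    · exact ⟨f i, fun h' => absurd h' h⟩
  choose c hc using H
  have hab := Germ.coe_lt.1 hab
  exact ⟨(c : Germ (U : Filter ι) X), Germ.coe_lt.2 (hab.mono fun i hi => (hc i hi).1),
    Germ.coe_lt.2 (hab.mono fun i hi => (hc i hi).2)⟩⟩

/-- The ultrapower of a scale. -/
def Scale.germ (S : Scale X) (U : Ultrafilter ι) : Scale (Germ (U : Filter ι) X) where
  h q := ((fun _ => S.h q : ι → X) : Germ (U : Filter ι) X)
  lo := Germ.map S.lo
  hi := Germ.map S.hi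
  h_strictMono _ _ hpq := Germ.coe_lt.2 (.of_forall fun _ => S.h_strictMono hpq)
  h_zero_le x := x.inductionOn fun _ => Germ.coe_le.2 (.of_forall fun _ => S.h_zero_le _)
  le_h_one x := x.inductionOn fun _ => Germ.coe_le.2 (.of_forall fun _ => S.le_h_one _)
  lo_le x := x.inductionOn fun _ => Germ.coe_le.2 (.of_forall fun _ => S.lo_le _)
  le_hi x := x.inductionOn fun _ => Germ.coe_le.2 (.of_forall fun _ => S.le_hi _)
  lo_lt_hi x := x.inductionOn fun _ h =>
    Germ.coe_lt.2 ((Germ.coe_lt.1 h).mono fun _ => S.lo_lt_hi _)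
  lt_lo x p q hpq := x.inductionOn fun _ h =>
    Germ.coe_le.2 ((Germ.coe_le.1 h).mono fun _ => S.lt_lo _ p q hpq)
  hi_lt x p q hpq := x.inductionOn fun _ h =>
    Germ.coe_le.2 ((Germ.coe_le.1 h).mono fun _ => S.hi_lt _ p q hpq)
  lo_h_lt r hr := Germ.coe_lt.2 (.of_forall fun _ => S.lo_h_lt r hr)
  lt_hi_h r hr hr' := Germ.coe_lt.2 (.of_forall fun _ => S.lt_hi_h r hr hr')

/-- The restriction of a scale to a closed subset. -/
def Scale.restrict (S : Scale X) (D : Set X) (hh : ∀ q, S.h q ∈ D) (hlo : ∀ x ∈ D, S.lo x ∈ D)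
    (hhi : ∀ x ∈ D, S.hi x ∈ D) : Scale D where
  h q := ⟨S.h q, hh q⟩
  lo x := ⟨S.lo x, hlo x x.2⟩
  hi x := ⟨S.hi x, hhi x x.2⟩
  h_strictMono _ _ hpq := S.h_strictMono hpq
  h_zero_le x := S.h_zero_le x.1
  le_h_one x := S.le_h_one x.1
  lo_le x := S.lo_le x.1
  le_hi x := S.le_hi x.1
  lo_lt_hi x := S.lo_lt_hi x.1
  lt_lo x := S.lt_lo x.1
  hi_lt x := S.hi_lt x.1
  lo_h_lt := S.lo_h_lt
  lt_hi_h := S.lt_hi_h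

end Germ

/-! ### Countable closures -/

/-- Countably many finitary operations have a countable closed set. -/
theorem exists_countable_closed {X : Type*} (𝓕 : Set (List X → X)) (h𝓕 : 𝓕.Countable) :
    ∃ S : Set X, S.Countable ∧ ∀ F ∈ 𝓕, ∀ l : List X, (∀ x ∈ l, x ∈ S) → F l ∈ S := by
  -- One round applies every operation to all lists from A. A list is finite and the stages
  -- increase, so its entries lie in a common stage.
  let step : Set X → Set X := fun A => A ∪ Set.image2 (fun F l => F l) 𝓕 {l | ∀ x ∈ l, x ∈ A}
  let C : ℕ → Set X := fun n => step^[n] ∅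
  have hC : ∀ n, C (n + 1) = step (C n) := fun n => Function.iterate_succ_apply' _ _ _
  have hmono : Monotone C := monotone_nat_of_le_succ fun n => by
    rw [hC]; exact Set.subset_union_left
  refine ⟨⋃ n, C n, Set.countable_iUnion fun n => ?_, fun F hF l hl => ?_⟩
  · induction n with
    | zero => exact Set.countable_empty
    | succ n ih =>
      rw [hC]
      refine ih.union (h𝓕.image2 ?_ _)
      have := ih.to_subtype
      rw [← Set.range_list_map_coe]
      exact Set.countable_range _
  · have : ∃ n, ∀ x ∈ l, x ∈ C n := by
      induction l with
      | nil => exact ⟨0, by simp⟩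
      | cons a l ih =>
        obtain ⟨n, hn⟩ := ih fun x hx => hl x (List.mem_cons_of_mem _ hx)
        obtain ⟨m, hm⟩ := Set.mem_iUnion.1 (hl a List.mem_cons_self)
        refine ⟨max m n, fun x hx => ?_⟩
        rcases List.mem_cons.1 hx with rfl | hx
        · exact hmono (le_max_left m n) hm
        · exact hmono (le_max_right m n) (hn x hx)
    obtain ⟨n, hn⟩ := this
    refine Set.mem_iUnion.2 ⟨n + 1, ?_⟩
    rw [hC]
    exact Or.inr ⟨F, hF, l, hn, rfl⟩

/-! ### Countability of the set of formulas and finiteness of free variables -/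

section Formulas

variable {L : FirstOrder.Language.{u, v}}

/-- The constructors form a countable family of list operations, and a set closed under them
contains every formula by induction. -/
instance [Countable L.Symbols] : Countable (Formula L) := by
  have hS : Countable ((Σ l, L.Functions l) ⊕ Σ l, L.Relations l) := ‹_›
  have hF : Countable (Σ l, L.Functions l) := (Sum.inl_injective (β := Σ l, L.Relations l)).countable
  have hR : Countable (Σ l, L.Relations l) :=
    (Sum.inr_injective (α := Σ l, L.Functions l)).countable
  have hR' : ∀ n, Countable (L.Relations n) := fun n =>
    (sigma_mk_injective (β := L.Relations) (i := n)).countable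
  let at' : List (Formula L) → ℕ → Formula L := fun l n => l.getD n (.const 0)
  obtain ⟨S, hS, hcl⟩ := exists_countable_closed
    (Set.range (fun r (_ : List (Formula L)) => Formula.const r)
    ∪ (Set.range (fun (p : Σ n, L.Relations n × (Fin n → L.Term ℕ)) (_ : List (Formula L)) =>
        Formula.pred p.2.1 p.2.2)
    ∪ ({fun l => .and (at' l 0) (at' l 1)} ∪ ({fun l => .imp (at' l 0) (at' l 1)}
    ∪ (Set.range (fun (x : ℕ) l => .all x (at' l 0))
    ∪ Set.range (fun (x : ℕ) l => .ex x (at' l 0)))))))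
    ((Set.countable_range _).union ((Set.countable_range _).union
      ((Set.countable_singleton _).union ((Set.countable_singleton _).union
        ((Set.countable_range _).union (Set.countable_range _))))))
  refine Set.countable_univ_iff.1 (hS.mono fun φ _ => ?_)
  induction φ with
  | const r => exact hcl _ (Or.inl ⟨r, rfl⟩) [] (by simp)
  | pred P t => exact hcl _ (Or.inr (Or.inl ⟨⟨_, P, t⟩, rfl⟩)) [] (by simp)
  | and φ ψ h h' =>
    exact hcl _ (Or.inr (Or.inr (Or.inl rfl))) [φ, ψ] (by simp [h trivial, h' trivial])
  | imp φ ψ h h' =>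
    exact hcl _ (Or.inr (Or.inr (Or.inr (Or.inl rfl)))) [φ, ψ] (by simp [h trivial, h' trivial])
  | all x φ h =>
    exact hcl _ (Or.inr (Or.inr (Or.inr (Or.inr (Or.inl ⟨x, rfl⟩))))) [φ] (by simp [h trivial])
  | ex x φ h =>
    exact hcl _ (Or.inr (Or.inr (Or.inr (Or.inr (Or.inr ⟨x, rfl⟩))))) [φ] (by simp [h trivial])

theorem finite_termVars (t : L.Term ℕ) : (termVars t).Finite := by
  induction t with
  | var x => exact Set.finite_singleton x
  | func f t ih => exact Set.finite_iUnion ih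

theorem Formula.finite_freeVars (φ : Formula L) : φ.freeVars.Finite := by
  induction φ with
  | const r => exact Set.finite_empty
  | pred P t => exact Set.finite_iUnion fun i => finite_termVars (t i)
  | and φ ψ h h' => exact h.union h'
  | imp φ ψ h h' => exact h.union h'
  | all x φ h => exact h.sdiff
  | ex x φ h => exact h.sdiff

end Formulas

/-! ### Łoś-type identities, Skolem closure and the collapsed structure -/

section Ultraproduct

variable {L : FirstOrder.Language.{u, v}} {ι : Type*} (U : Ultrafilter ι)
  (M : ι → Structure.{u, v, w} L)

/-- The value of a formula in the ultraproduct of structures, at an assignment by representatives. -/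
noncomputable def germVal (φ : Formula L) (σ : ℕ → ∀ i, (M i).carrier) :
    Germ (U : Filter ι) TruthValue :=
  ((fun i => (M i).val φ fun n => σ n i : ι → TruthValue) : Germ (U : Filter ι) TruthValue)

variable {U M}

theorem germVal_congr {φ : Formula L} {σ τ : ℕ → ∀ i, (M i).carrier}
    (h : ∀ x ∈ φ.freeVars, σ x = τ x) : germVal U M φ σ = germVal U M φ τ :=
  congrArg (fun f : ι → TruthValue => (f : Germ (U : Filter ι) TruthValue))
    (funext fun i => (M i).val_congr φ fun x hx => congrFun (h x hx) i)

theorem update_apply_apply (σ : ℕ → ∀ i, (M i).carrier) (x : ℕ) (a : ∀ i, (M i).carrier) (i : ι) :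
    (fun n => Function.update σ x a n i) = Function.update (fun n => σ n i) x (a i) := by
  funext n
  by_cases h : n = x
  · subst h; simp
  · simp [h]

theorem germVal_and (φ ψ : Formula L) (σ : ℕ → ∀ i, (M i).carrier) :
    germVal U M (.and φ ψ) σ = max (germVal U M φ σ) (germVal U M ψ σ) := by
  rw [Germ.max_def]; rfl

theorem germVal_imp (φ ψ : Formula L) (σ : ℕ → ∀ i, (M i).carrier) :
    germVal U M (.imp φ ψ) σ = if germVal U M ψ σ ≤ germVal U M φ σ
      then (TruthValue.scale.germ U).h 0 else germVal U M ψ σ := by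
  split_ifs with h
  · exact Germ.coe_eq.2 ((Germ.coe_le.1 h).mono fun i hi => if_pos hi)
  · exact Germ.coe_eq.2 ((Germ.coe_lt.1 (not_le.1 h)).mono fun i hi => if_neg (not_le.2 hi))

theorem germVal_le_all (x : ℕ) (φ : Formula L) (σ : ℕ → ∀ i, (M i).carrier)
    (a : ∀ i, (M i).carrier) :
    germVal U M φ (Function.update σ x a) ≤ germVal U M (.all x φ) σ :=
  Germ.coe_le.2 (.of_forall fun i => by
    beta_reduce
    rw [update_apply_apply]
    exact (TruthValue.isLUB_sSup _).1 ⟨a i, rfl⟩)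

theorem germVal_ex_le (x : ℕ) (φ : Formula L) (σ : ℕ → ∀ i, (M i).carrier)
    (a : ∀ i, (M i).carrier) :
    germVal U M (.ex x φ) σ ≤ germVal U M φ (Function.update σ x a) :=
  Germ.coe_le.2 (.of_forall fun i => by
    beta_reduce
    rw [update_apply_apply]
    exact (TruthValue.isGLB_sInf _).1 ⟨a i, rfl⟩)

/-- Witnesses are chosen coordinatewise, arbitrarily where `d` is not below the supremum. With
`germVal_le_all`, the value of a universal formula is a genuine supremum in the ultrapower, although
the ultrapower need not be complete. -/
theorem exists_lt_germVal (x : ℕ) (φ : Formula L) (σ : ℕ → ∀ i, (M i).carrier)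
    (d : Germ (U : Filter ι) TruthValue) (hd : d < germVal U M (.all x φ) σ) :
    ∃ a, d < germVal U M φ (Function.update σ x a) := by
  induction d using Germ.inductionOn with | _ d =>
  have H : ∀ i, ∃ a, d i < (M i).val (.all x φ) (fun n => σ n i) →
      d i < (M i).val φ (Function.update (fun n => σ n i) x a) := fun i => by
    by_cases h : d i < (M i).val (.all x φ) (fun n => σ n i)
    · obtain ⟨_, ⟨a, rfl⟩, ha⟩ := (lt_isLUB_iff (TruthValue.isLUB_sSup _)).1 h
      exact ⟨a, fun _ => ha⟩
    · exact ⟨(M i).nonempty.some, fun h' => absurd h' h⟩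
  choose a ha using H
  refine ⟨a, Germ.coe_lt.2 ((Germ.coe_lt.1 hd).mono fun i hi => ?_)⟩
  rw [update_apply_apply]
  exact ha i hi

theorem exists_germVal_lt (x : ℕ) (φ : Formula L) (σ : ℕ → ∀ i, (M i).carrier)
    (d : Germ (U : Filter ι) TruthValue) (hd : germVal U M (.ex x φ) σ < d) :
    ∃ a, germVal U M φ (Function.update σ x a) < d := by
  induction d using Germ.inductionOn with | _ d =>
  have H : ∀ i, ∃ a, (M i).val (.ex x φ) (fun n => σ n i) < d i →
      (M i).val φ (Function.update (fun n => σ n i) x a) < d i := fun i => by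
    by_cases h : (M i).val (.ex x φ) (fun n => σ n i) < d i
    · obtain ⟨_, ⟨a, rfl⟩, ha⟩ := (isGLB_lt_iff (TruthValue.isGLB_sInf _)).1 h
      exact ⟨a, fun _ => ha⟩
    · exact ⟨(M i).nonempty.some, fun h' => absurd h' h⟩
  choose a ha using H
  refine ⟨a, Germ.coe_lt.2 ((Germ.coe_lt.1 hd).mono fun i hi => ?_)⟩
  rw [update_apply_apply]
  exact ha i hi

variable (U M)

/-- A set of points and a set of values of an ultraproduct that form a Skolem-closed part of it. -/
structure IsSkolemClosed (A : Set (∀ i, (M i).carrier)) (D : Set (Germ (U : Filter ι) TruthValue)) :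
    Prop where
  nonempty : A.Nonempty
  fun_mem : ∀ {n : ℕ} (f : L.Functions n) (a : Fin n → ∀ i, (M i).carrier), (∀ j, a j ∈ A) →
    (fun i => (M i).funMap f fun j => a j i) ∈ A
  val_mem : ∀ φ (σ : ℕ → ∀ i, (M i).carrier), (∀ n, σ n ∈ A) → germVal U M φ σ ∈ D
  lo_mem : ∀ d ∈ D, (TruthValue.scale.germ U).lo d ∈ D
  hi_mem : ∀ d ∈ D, (TruthValue.scale.germ U).hi d ∈ D
  dense : ∀ a ∈ D, ∀ b ∈ D, a < b → ∃ c ∈ D, a < c ∧ c < b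
  exists_lt : ∀ x φ (σ : ℕ → ∀ i, (M i).carrier), (∀ n, σ n ∈ A) → ∀ d ∈ D,
    d < germVal U M (.all x φ) σ → ∃ a ∈ A, d < germVal U M φ (Function.update σ x a)
  lt_exists : ∀ x φ (σ : ℕ → ∀ i, (M i).carrier), (∀ n, σ n ∈ A) → ∀ d ∈ D,
    germVal U M (.ex x φ) σ < d → ∃ a ∈ A, germVal U M φ (Function.update σ x a) < d

/-- Points and values are closed off simultaneously, in the disjoint union of the two sorts, because
Skolem witnesses for quantifiers depend on a value as well as on points. -/
theorem exists_countable_isSkolemClosed [Countable L.Symbols] :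
    ∃ A D, IsSkolemClosed U M A D ∧ A.Countable ∧ D.Countable := by
  classical
  have hF : Countable (Σ l, L.Functions l) :=
    (Sum.inl_injective (β := Σ l, L.Relations l)).countable
  let P := ∀ i, (M i).carrier
  let G := Germ (U : Filter ι) TruthValue
  let S := TruthValue.scale.germ U
  -- A list codes an assignment through `pt`, with `a₀` beyond its end; `vl` reads its values.
  -- Entries of the wrong sort get harmless defaults.
  let a₀ : P := fun i => (M i).nonempty.some
  let pt : List (P ⊕ G) → ℕ → P := fun l n => (l.getD n (.inl a₀)).elim id fun _ => a₀
  let vl : List (P ⊕ G) → ℕ → G := fun l n => (l.getD n (.inl a₀)).elim (fun _ => S.h 0) id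
  have hsk : ∀ (p : ℕ × Formula L) (σ : ℕ → P) (d : G), ∃ a, d < germVal U M (.all p.1 p.2) σ →
      d < germVal U M p.2 (Function.update σ p.1 a) := fun p σ d => by
    by_cases h : d < germVal U M (.all p.1 p.2) σ
    · exact (exists_lt_germVal _ _ _ _ h).imp fun a ha _ => ha
    · exact ⟨a₀, fun h' => absurd h' h⟩
  have hsk' : ∀ (p : ℕ × Formula L) (σ : ℕ → P) (d : G), ∃ a, germVal U M (.ex p.1 p.2) σ < d →
      germVal U M p.2 (Function.update σ p.1 a) < d := fun p σ d => by
    by_cases h : germVal U M (.ex p.1 p.2) σ < d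
    · exact (exists_germVal_lt _ _ _ _ h).imp fun a ha _ => ha
    · exact ⟨a₀, fun h' => absurd h' h⟩
  have hmid : ∀ a b : G, ∃ c, a < b → a < c ∧ c < b := fun a b => by
    by_cases h : a < b
    · exact (exists_between h).imp fun c hc _ => hc
    · exact ⟨a, fun h' => absurd h' h⟩
  choose sk sk_spec using hsk
  choose sk' sk'_spec using hsk'
  choose mid mid_spec using hmid
  obtain ⟨C, hC, hcl⟩ := exists_countable_closed
    (({fun _ => .inl a₀, fun l => .inr (S.lo (vl l 0)), fun l => .inr (S.hi (vl l 0)),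
        fun l => .inr (mid (vl l 0) (vl l 1))} : Set (List (P ⊕ G) → P ⊕ G))
    ∪ (Set.range (fun (f : Σ n, L.Functions n) l =>
        .inl fun i => (M i).funMap f.2 fun j => pt l j i)
    ∪ (Set.range (fun φ l => .inr (germVal U M φ (pt l)))
    ∪ (Set.range (fun p l => .inl (sk p (pt l.tail) (vl l 0)))
    ∪ Set.range (fun p l => .inl (sk' p (pt l.tail) (vl l 0)))))))
    ((Set.toFinite _).countable.union ((Set.countable_range _).union
      ((Set.countable_range _).union ((Set.countable_range _).union (Set.countable_range _)))))
  let A : Set P := {a | .inl a ∈ C}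
  let D : Set G := {d | .inr d ∈ C}
  -- A formula has finitely many free variables, so a finite list determines its value.
  have hlist : ∀ (φ : Formula L) (σ : ℕ → P), (∀ n, σ n ∈ A) → ∃ l : List (P ⊕ G),
      (∀ z ∈ l, z ∈ C) ∧ (∀ n ∈ φ.freeVars, pt l n = σ n) := by
    intro φ σ hσ
    obtain ⟨k, hk⟩ := φ.finite_freeVars.bddAbove
    refine ⟨(List.range (k + 1)).map fun n => .inl (σ n), ?_, fun n hn => ?_⟩
    · intro z hz
      obtain ⟨n, -, rfl⟩ := List.mem_map.1 hz
      exact hσ n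
    · have : n < k + 1 := Nat.lt_succ_of_le (hk hn)
      simp [pt, List.getD, this]
  have hupd : ∀ (x : ℕ) (φ : Formula L) (σ τ : ℕ → P) (a : P),
      (∀ n ∈ (Formula.all x φ).freeVars, σ n = τ n) →
      germVal U M φ (Function.update σ x a) = germVal U M φ (Function.update τ x a) := by
    intro x φ σ τ a h
    refine germVal_congr fun n hn => ?_
    by_cases hnx : n = x
    · subst hnx; simp
    · simpa [hnx] using h n ⟨hn, hnx⟩
  refine ⟨A, D, ⟨⟨a₀, hcl (fun _ => .inl a₀) (Or.inl (by simp)) [] (by simp)⟩, fun {n} f a ha => ?_,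
    fun φ σ hσ => ?_, fun d hd => ?_, fun d hd => ?_, fun a ha b hb hab => ?_,
    fun x φ σ hσ d hd hlt => ?_, fun x φ σ hσ d hd hlt => ?_⟩,
    hC.preimage Sum.inl_injective, hC.preimage Sum.inr_injective⟩
  · change Sum.inl _ ∈ C
    have := hcl _ (Or.inr (Or.inl ⟨⟨n, f⟩, rfl⟩)) (List.ofFn fun j => .inl (a j)) (by
      intro z hz
      obtain ⟨j, rfl⟩ := List.mem_ofFn.1 hz
      exact ha j)
    simpa [pt, List.getD] using this
  · obtain ⟨l, hl, hl'⟩ := hlist φ σ hσ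
    have := hcl _ (Or.inr (Or.inr (Or.inl ⟨φ, rfl⟩))) l hl
    change Sum.inr _ ∈ C
    rwa [← germVal_congr hl']
  · exact hcl (fun l => .inr (S.lo (vl l 0))) (Or.inl (by simp)) [.inr d]
      (by simpa using show Sum.inr d ∈ C from hd)
  · exact hcl (fun l => .inr (S.hi (vl l 0))) (Or.inl (by simp)) [.inr d]
      (by simpa using show Sum.inr d ∈ C from hd)
  · exact ⟨mid a b, hcl (fun l => .inr (mid (vl l 0) (vl l 1))) (Or.inl (by simp)) [.inr a, .inr b]
      (by simpa using show Sum.inr a ∈ C ∧ Sum.inr b ∈ C from ⟨ha, hb⟩), mid_spec a b hab⟩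
  · obtain ⟨l, hl, hl'⟩ := hlist (.all x φ) σ hσ
    refine ⟨sk (x, φ) (pt l) d, hcl _ (Or.inr (Or.inr (Or.inr (Or.inl ⟨(x, φ), rfl⟩))))
      (.inr d :: l) (by simpa using show Sum.inr d ∈ C ∧ _ from ⟨hd, by simpa using hl⟩), ?_⟩
    rw [← hupd x φ _ _ _ hl']
    exact sk_spec (x, φ) (pt l) d (by rwa [germVal_congr hl'])
  · obtain ⟨l, hl, hl'⟩ := hlist (.ex x φ) σ hσ
    refine ⟨sk' (x, φ) (pt l) d, hcl _ (Or.inr (Or.inr (Or.inr (Or.inr ⟨(x, φ), rfl⟩))))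
      (.inr d :: l) (by simpa using show Sum.inr d ∈ C ∧ _ from ⟨hd, by simpa using hl⟩), ?_⟩
    rw [← hupd x φ _ _ _ hl']
    exact sk'_spec (x, φ) (pt l) d (by rwa [germVal_congr hl'])

/-- Over a countable language, an ultraproduct of structures is approximated by a genuine
structure, in which only values infinitely close to absolute truth are collapsed. -/
theorem exists_structure_of_ultraproduct [Countable L.Symbols] :
    ∃ N : Structure.{u, v, w} L, ∀ φ : Sentence L,
      ((∀ᶠ i in (U : Filter ι), (M i).Satisfies φ) → N.Satisfies φ) ∧
      ∀ q : Set.Icc (0 : ℚ) 1, (∀ᶠ i in (U : Filter ι), ∀ σ, TruthValue.hat q < (M i).val φ.1 σ) →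
        ∀ σ, TruthValue.hat q ≤ N.val φ.1 σ := by
  classical
  obtain ⟨A, D, hAD, hA, hD⟩ := exists_countable_isSkolemClosed U M
  have hconst : ∀ q, (TruthValue.scale.germ U).h q ∈ D := fun q => by
    obtain ⟨a, ha⟩ := hAD.nonempty
    exact hAD.val_mem (.const q) (fun _ => a) fun _ => ha
  have : Countable A := hA.to_subtype
  -- Countability lets the universe of points be replaced by a copy in `Type w`, whatever the
  -- universe of the index set.
  have : Small.{w} A := Countable.toSmall _
  have : Countable D := hD.to_subtype
  have : DenselyOrdered D := ⟨fun a b hab => by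
    obtain ⟨c, hc, h⟩ := hAD.dense a a.2 b b.2 hab
    exact ⟨⟨c, hc⟩, h⟩⟩
  obtain ⟨e, eh, emono, elt, ebi⟩ :=
    ((TruthValue.scale.germ U).restrict D hconst hAD.lo_mem hAD.hi_mem).exists_collapse
  let e' : Germ (U : Filter ι) TruthValue → TruthValue := fun d =>
    if h : d ∈ D then e ⟨d, h⟩ else TruthValue.zeroHat
  have he' : ∀ d (h : d ∈ D), e' d = e ⟨d, h⟩ := fun d h => dif_pos h
  have eh' : ∀ q, e' ((TruthValue.scale.germ U).h q) = TruthValue.hat q := fun q =>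
    (he' _ (hconst q)).trans (eh q)
  let ν : Shrink.{w} A → ∀ i, (M i).carrier := fun c => ((equivShrink.{w} A).symm c).1
  have hν : ∀ c, ν c ∈ A := fun c => ((equivShrink.{w} A).symm c).2
  have hν' : ∀ a (h : a ∈ A), ν (equivShrink.{w} A ⟨a, h⟩) = a := fun a h => by simp [ν]
  let N : Structure.{u, v, w} L :=
    { carrier := Shrink.{w} A
      nonempty := ⟨equivShrink.{w} A ⟨_, hAD.nonempty.some_mem⟩⟩
      predMap := fun P a => e' ((fun i => (M i).predMap P fun j => ν (a j) i : ι → TruthValue) :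
        Germ (U : Filter ι) TruthValue)
      funMap := fun f a => equivShrink.{w} A ⟨_, hAD.fun_mem f (fun j => ν (a j)) fun j => hν _⟩ }
  have hterm : ∀ (t : L.Term ℕ) (σ : ℕ → N.carrier) (i : ι),
      ν (N.termVal σ t) i = (M i).termVal (fun n => ν (σ n) i) t := by
    intro t σ i
    induction t with
    | var x => rfl
    | func f t ih =>
      simp only [Structure.termVal]
      rw [← funext ih]
      exact congrFun (hν' _ _) i
  have hmem : ∀ (φ : Formula L) (σ : ℕ → N.carrier), germVal U M φ (ν ∘ σ) ∈ D :=
    fun φ σ => hAD.val_mem φ _ fun n => hν _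
  have hupd : ∀ (σ : ℕ → N.carrier) (x : ℕ) (c : N.carrier),
      ν ∘ Function.update σ x c = Function.update (ν ∘ σ) x (ν c) := fun σ x c =>
    Function.comp_update ν σ x c
  have hval : ∀ (φ : Formula L) (σ : ℕ → N.carrier),
      N.val φ σ = e' (germVal U M φ (ν ∘ σ)) := by
    intro φ
    induction φ with
    | const r => exact fun σ => (eh' r).symm
    | pred P t =>
      intro σ
      simp only [Structure.val, germVal, N]
      congr 2
      funext i
      congr 1
      funext j
      exact hterm (t j) σ i
    | and φ ψ h h' =>
      intro σ
      have hm := hmem (.and φ ψ) σ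
      rw [germVal_and] at hm
      rw [Structure.val, h, h', germVal_and, he' _ (hmem φ σ), he' _ (hmem ψ σ), he' _ hm,
        ← emono.map_max]
      congr 1
    | imp φ ψ h h' =>
      intro σ
      rw [Structure.val, h, h', germVal_imp, TruthValue.imp]
      by_cases hle : germVal U M ψ (ν ∘ σ) ≤ germVal U M φ (ν ∘ σ)
      · rw [if_pos hle, eh', if_pos]
        · rfl
        · rw [he' _ (hmem φ σ), he' _ (hmem ψ σ)]
          exact emono hle
      · rw [if_neg hle]
        split_ifs with hle'
        -- The order of the two values is lost under the collapse only if the larger one, that of ψ,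
        -- becomes absolute truth; the two sides then agree.
        · by_contra hne
          rw [he' _ (hmem φ σ), he' _ (hmem ψ σ)] at hle'
          rw [he' _ (hmem ψ σ)] at hne
          exact (elt ⟨_, hmem φ σ⟩ ⟨_, hmem ψ σ⟩ (not_le.1 hle) (Ne.symm hne)).not_ge hle'
        · rfl
    | all x φ ih =>
      intro σ
      refine (TruthValue.isLUB_sSup _).unique ⟨?_, fun b hb => not_lt.1 fun hlt => ?_⟩
      · rintro _ ⟨c, rfl⟩
        beta_reduce
        rw [ih, he' _ (hmem _ _), he' _ (hmem _ _)]
        refine emono (Subtype.mk_le_mk.2 ?_)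
        rw [hupd]
        exact germVal_le_all x φ _ _
      · rw [he' _ (hmem _ _)] at hlt
        -- Continuity of the collapse supplies a value d in D below the supremum whose image still
        -- exceeds b; a Skolem witness above d contradicts the bound b.
        obtain ⟨⟨d, hd⟩, hdlt, hbd⟩ := ebi.left _ _ hlt
        obtain ⟨a, ha, hda⟩ := hAD.exists_lt x φ _ (fun n => hν _) d hd hdlt
        have := hb ⟨equivShrink.{w} A ⟨a, ha⟩, rfl⟩
        beta_reduce at this
        rw [ih, he' _ (hmem _ _)] at this
        refine (hbd.trans_le (emono (Subtype.mk_le_mk.2 ?_))).not_ge this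
        rw [hupd, hν']
        exact hda.le
    | ex x φ ih =>
      intro σ
      refine (TruthValue.isGLB_sInf _).unique ⟨?_, fun b hb => not_lt.1 fun hlt => ?_⟩
      · rintro _ ⟨c, rfl⟩
        beta_reduce
        rw [ih, he' _ (hmem _ _), he' _ (hmem _ _)]
        refine emono (Subtype.mk_le_mk.2 ?_)
        rw [hupd]
        exact germVal_ex_le x φ _ _
      · rw [he' _ (hmem _ _)] at hlt
        obtain ⟨⟨d, hd⟩, hdlt, hbd⟩ := ebi.right _ _ hlt
        obtain ⟨a, ha, hda⟩ := hAD.lt_exists x φ _ (fun n => hν _) d hd hdlt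
        have := hb ⟨equivShrink.{w} A ⟨a, ha⟩, rfl⟩
        beta_reduce at this
        rw [ih, he' _ (hmem _ _)] at this
        refine ((emono (Subtype.mk_le_mk.2 ?_)).trans_lt hbd).not_ge this
        rw [hupd, hν']
        exact hda.le
  refine ⟨N, fun φ => ⟨fun h σ => ?_, fun q h σ => ?_⟩⟩
  · rw [hval, show germVal U M φ.1 (ν ∘ σ) = (TruthValue.scale.germ U).h 0 from
      Germ.coe_eq.2 (h.mono fun i hi => hi _), eh']
    rfl
  · rw [hval, ← eh', he' _ (hconst q), he' _ (hmem _ _)]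
    exact emono (Germ.coe_le.2 (h.mono fun i hi => (hi _).le))

end Ultraproduct

/-! ### The two directions of approximate compactness -/

theorem Structure.satisfies_const_imp_iff {L : FirstOrder.Language.{u, v}}
    (M : Structure.{u, v, w} L) (q : Set.Icc (0 : ℚ) 1) (φ : Sentence L) :
    M.Satisfies (.imp (.const q) φ) ↔ ∀ σ, M.val φ.1 σ ≤ TruthValue.hat q := by
  refine forall_congr' fun σ => ?_
  change (if M.val φ.1 σ ≤ TruthValue.hat q then TruthValue.zeroHat else M.val φ.1 σ) = _ ↔ _
  split_ifs with h
  · simpa using h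
  · simp only [h, iff_false]
    exact fun h0 => h (h0 ▸ TruthValue.zeroHat_le _)

theorem Structure.val_eq_val {L : FirstOrder.Language.{u, v}} (M : Structure.{u, v, w} L)
    (φ : Sentence L) (σ τ : ℕ → M.carrier) : M.val φ.1 σ = M.val φ.1 τ :=
  M.val_congr _ fun x hx => by simp [φ.2] at hx

theorem TruthValue.eq_zeroHat_of_forall_le {x : TruthValue} (h : ∀ n, x ≤ hat (unitFrac n)) :
    x = zeroHat := by
  by_contra hne
  have hpos := fst_pos (lt_of_le_of_ne (zeroHat_le x) (Ne.symm hne))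
  obtain ⟨n, hn⟩ := exists_nat_one_div_lt hpos
  have hle : x.fst ≤ 1 / ((n : ℝ) + 1) := by
    have : x.fst ≤ ((unitFrac n.succPNat : ℚ) : ℝ) :=
      ((le_iff _ _).1 (h n.succPNat)).elim (fun h => le_of_lt h) fun h => h.1.le
    simpa [unitFrac] using this
  exact hle.not_gt hn

theorem exists_finite_entails {L : FirstOrder.Language.{u, v}} [Countable L.Symbols]
    {T : Theory L} {φ : Sentence L} (h : Entails.{u, v, w} T φ) (n : ℕ+) :
    ∃ T₀ : Theory L, T₀ ⊆ T ∧ T₀.Finite ∧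
      Entails.{u, v, w} T₀ (.imp (.const (unitFrac n)) φ) := by
  classical
  by_contra! hcon
  have H : ∀ F : Finset T, ∃ M : Structure.{u, v, w} L, (∀ ψ ∈ F, M.Satisfies ψ.1) ∧
      ∀ σ, TruthValue.hat (unitFrac n) < M.val φ.1 σ := fun F => by
    have := hcon (Subtype.val '' (F : Set T)) (by simp) (F.finite_toSet.image _)
    unfold Entails at this
    push Not at this
    obtain ⟨M, hM, hφ⟩ := this
    refine ⟨M, fun ψ hψ => hM _ ⟨ψ, hψ, rfl⟩, fun σ => ?_⟩
    rw [Structure.satisfies_const_imp_iff] at hφ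
    push Not at hφ
    obtain ⟨τ, hτ⟩ := hφ
    rwa [M.val_eq_val φ σ τ]
  choose M hM hM' using H
  -- The ultrafilter refines `atTop` on finite subsets of `T`, so it contains each cone of subsets
  -- containing a given ψ; hence every sentence of `T` holds in almost all of the models.
  obtain ⟨N, hN⟩ := exists_structure_of_ultraproduct (Ultrafilter.of (atTop : Filter (Finset T))) M
  have hNT : N.SatisfiesTheory T := fun ψ hψ => (hN ψ).1 <| Ultrafilter.of_le _ <|
    (eventually_ge_atTop ({⟨ψ, hψ⟩} : Finset T)).mono fun F hF =>
      hM F ⟨ψ, hψ⟩ (hF (Finset.mem_singleton_self _))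
  have σ : ℕ → N.carrier := fun _ => N.nonempty.some
  have hle := (hN φ).2 (unitFrac n) (.of_forall hM') σ
  rw [h N hNT σ] at hle
  have hpos : TruthValue.zeroHat < TruthValue.hat (unitFrac n) := by
    refine (TruthValue.lt_iff _ _).2 (Or.inl ?_)
    simp [TruthValue.zeroHat, TruthValue.hat, unitFrac]
  exact hle.not_gt hpos

theorem entails_of_forall_finite {L : FirstOrder.Language.{u, v}} {T : Theory L} {φ : Sentence L}
    (h : ∀ n : ℕ+, ∃ T₀ : Theory L, T₀ ⊆ T ∧ T₀.Finite ∧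
      Entails.{u, v, w} T₀ (.imp (.const (unitFrac n)) φ)) : Entails.{u, v, w} T φ :=
  fun M hM σ => TruthValue.eq_zeroHat_of_forall_le fun n => by
    obtain ⟨T₀, hT₀, -, hφ⟩ := h n
    exact (M.satisfies_const_imp_iff _ _).1 (hφ M fun ψ hψ => hM ψ (hT₀ hψ)) σ

end RGL

theorem mainTheorem3 (L : FirstOrder.Language.{u, v}) [Countable L.Symbols]
    (T : RGL.Theory L) (φ : RGL.Sentence L) :
    RGL.Entails.{u, v, w} T φ ↔
      ∀ n : ℕ+, ∃ T₀ : RGL.Theory L, T₀ ⊆ T ∧ T₀.Finite ∧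
        RGL.Entails.{u, v, w} T₀ (RGL.Sentence.imp (RGL.Sentence.const (RGL.unitFrac n)) φ) :=
  ⟨fun h n => RGL.exists_finite_entails h n, RGL.entails_of_forall_finite⟩
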